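/- Let $m\ge 1$, $\sigma>0$, and consider $n$ sensors observing a linear dynamical system with states in $\mathbb{R}^m$. Sensor $j$ has at time $s$ the (random) measurement vector $\mathbf a_j(s)\in\mathbb{R}^m$, the measurement noise has covariance $\sigma^2\mathbf I_n$, the transition matrices are $\mathbf H(s)$, the process noise has positive definite covariance $\mathbf Q(s)$ (for instance $\sigma^2\mathbf I_m$), and the initial state has covariance $\boldsymbol\Sigma_x\succeq 0$. If at each time $s$ the measurements of a set $S_s\subseteq[n]$ of sensors (chosen in an arbitrary way) are used, the prediction error covariance $\mathbf P_{s|s-1}$ and the filtered error covariance $\mathbf P_{s|s}$ of the Kalman filter are given by $\mathbf P_{0|0}=\boldsymbol\Sigma_x$ and, for $s\ge 1$, $$\mathbf P_{s|s-1}=\mathbf H(s)\mathbf P_{s-1|s-1}\mathbf H(s)^\top+\mathbf Q(s),\qquad \mathbf P_{s|s}=\Big(\mathbf P_{s|s-1}^{-1}+\sigma^{-2}\sum_{i\in S_s}\mathbf a_i(s)\mathbf a_i(s)^\top\Big)^{-1}.$$ Fix a time $t\ge 1$, write $\mathbf P=\mathbf P_{t|t-1}$, and for $S\subseteq[n]$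 put $$\mathbf F_S=\mathbf P^{-1}+\sigma^{-2}\sum_{i\in S}\mathbf a_i(t)\mathbf a_i(t)^\top,\qquad f(S)=\mathrm{Tr}(\mathbf P-\mathbf F_S^{-1}),\qquad f_i(S)=f(S\cup\{i\})-f(S).$$ The maximum element-wise curvature of $f$ is $\mathcal C_{\max}=\max_{1\le l\le n-1}\mathcal C_l$, where $\mathcal C_l$ is the maximum of $f_i(T)/f_i(S)$ over all $S\subset T\subset[n]$ and $i\in[n]\setminus T$ with $|T\setminus S|=l$ (with $0/0=0$, and with the maximum over an empty family equal to $0$). Suppose that the random vectors $\mathbf a_1(t),\dots,\mathbf a_n(t)$ are independent with mean zero and covariance matrix $\sigma_a^2\mathbf I_m$, and that $\|\mathbf a_j(t)\|_2^2\le C$ almost surely for every $j$. Then for every $q>0$, with probability at least $$1-m\exp\left(\frac{-q^2/2}{(C-\sigma_a^2)(n\sigma_a^2+q/3)}\right)$$ (the exponential being read as $0$ if $C=\sigma_a^2$), the number $\phi=1/\lambda_{\max}(\mathbf F_{[n]})$ satisfies $$\phi\ \ge\ \phi_0:=\left(\frac{1}{\lambda_{\min}(\mathbf P)}+\frac{n\sigma_a^2+q}{\sigma^2}\right)^{-1}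 \qquad\text{and}\qquad \mathcal C_{\max}\ \le\ \frac{\lambda_{\max}(\mathbf P)^2\,\big(\sigma^2+\lambda_{\max}(\mathbf P)\,C\big)}{\phi^2\,(\sigma^2+\phi\, C)},$$ and the last inequality holds also with $\phi_0$ in place of $\phi$. -/

import Mathlib

open MeasureTheory ProbabilityTheory
open scoped ENNReal

noncomputable section

namespace SensorScheduling

/-- The marginal value `f_i(S) = f(S ∪ {i}) - f(S)`. -/
def marginal {α : Type*} [DecidableEq α] (f : Finset α → ℝ) (i : α) (S : Finset α) : ℝ :=
  f (insert i S) - f S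

/-- The set of triples `(S, T, i)` with `S ⊂ T ⊂ X`, `i ∈ X \ T` and `|T \ S| = l`. -/
def curvatureTriples (α : Type*) [DecidableEq α] (l : ℕ) : Set (Finset α × Finset α × α) :=
  {x | x.1 ⊆ x.2.1 ∧ x.2.2 ∉ x.2.1 ∧ (x.2.1 \ x.1).card = l}

/-- The element-wise curvature `C_l` of a monotone non-decreasing set function: the maximum of
`f_i(T) / f_i(S)` over the above triples. The marginals are non-negative, and the quotient is taken
in `[0, ∞]`, so that `x / 0 = ∞` for `x > 0`, and `0 / 0 = 0`. -/
def elementCurvature {α : Type*} [DecidableEq α] (f : Finset α → ℝ) (l : ℕ) : ℝ≥0∞ :=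
  ⨆ x ∈ curvatureTriples α l,
    ENNReal.ofReal (marginal f x.2.2 x.2.1) / ENNReal.ofReal (marginal f x.2.2 x.1)

/-- The maximum element-wise curvature `C_max = max_{1 ≤ l ≤ n - 1} C_l`, where `n = |X|`. -/
def maxCurvature {α : Type*} [Fintype α] [DecidableEq α] (f : Finset α → ℝ) : ℝ≥0∞ :=
  (Finset.Icc 1 (Fintype.card α - 1)).sup (elementCurvature f)

variable {m n : ℕ}

/-- The largest eigenvalue of a real symmetric matrix (of positive size). -/
def lamMax (A : Matrix (Fin m) (Fin m) ℝ) : ℝ := sSup (spectrum ℝ A)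

/-- The smallest eigenvalue of a real symmetric matrix (of positive size). -/
def lamMin (A : Matrix (Fin m) (Fin m) ℝ) : ℝ := sInf (spectrum ℝ A)

/-- The Fisher information matrix `F_S = P⁻¹ + σ⁻² ∑_{i ∈ S} a_i a_iᵀ`. -/
def fisher (σ : ℝ) (P : Matrix (Fin m) (Fin m) ℝ) (a : Fin n → EuclideanSpace ℝ (Fin m))
    (S : Finset (Fin n)) : Matrix (Fin m) (Fin m) ℝ :=
  P⁻¹ + (σ ^ 2)⁻¹ • ∑ i ∈ S, Matrix.vecMulVec (a i).ofLp (a i).ofLp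

/-- The objective function `f(S) = Tr (P - F_S⁻¹)` of the sensor scheduling problem. -/
def objective (σ : ℝ) (P : Matrix (Fin m) (Fin m) ℝ) (a : Fin n → EuclideanSpace ℝ (Fin m))
    (S : Finset (Fin n)) : ℝ :=
  (P - (fisher σ P a S)⁻¹).trace

/-- The filtered error covariance `P_{t|t}` of the Kalman filter that uses at each time `s` the
measurements of the sensors in `S s`, with `P_{0|0} = P₀` (the covariance of the initial state). The matrix inside `fisher` is the
prediction error covariance `P_{t+1|t} = H(t+1) P_{t|t} H(t+1)ᵀ + Q(t+1)`. -/
def filteredCov (H Q : ℕ → Matrix (Fin m) (Fin m) ℝ) (P₀ : Matrix (Fin m) (Fin m) ℝ) (σ : ℝ)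
    (a : ℕ → Fin n → EuclideanSpace ℝ (Fin m)) (S : ℕ → Finset (Fin n)) :
    ℕ → Matrix (Fin m) (Fin m) ℝ
  | 0 => P₀
  | t + 1 => (fisher σ
      (H (t + 1) * filteredCov H Q P₀ σ a S t * (H (t + 1)).transpose + Q (t + 1))
      (a (t + 1)) (S (t + 1)))⁻¹

/-- The prediction error covariance `P_{t|t-1} = H(t) P_{t-1|t-1} H(t)ᵀ + Q(t)`, for `t ≥ 1`. -/
def predictionCov (H Q : ℕ → Matrix (Fin m) (Fin m) ℝ) (P₀ : Matrix (Fin m) (Fin m) ℝ) (σ : ℝ)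
    (a : ℕ → Fin n → EuclideanSpace ℝ (Fin m)) (S : ℕ → Finset (Fin n)) (t : ℕ) :
    Matrix (Fin m) (Fin m) ℝ :=
  H t * filteredCov H Q P₀ σ a S (t - 1) * (H t).transpose + Q t

/-- The bound `m exp (-(q² / 2) / ((C - σa²) (n σa² + q / 3)))` on the failure probability, with
its limit value `exp (-∞) = 0` where `C = σa²`. -/
def failureBound (m n : ℕ) (σa C q : ℝ) : ℝ :=
  if C = σa ^ 2 then 0
  else m * Real.exp (-(q ^ 2 / 2) / ((C - σa ^ 2) * (n * σa ^ 2 + q / 3)))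

/-- The right-hand side `λ_max(P)² (σ² + λ_max(P) C) / (φ² (σ² + φ C))` of the curvature bound. -/
def curvatureBound (σ C : ℝ) (P : Matrix (Fin m) (Fin m) ℝ) (φ : ℝ) : ℝ :=
  lamMax P ^ 2 * (σ ^ 2 + lamMax P * C) / (φ ^ 2 * (σ ^ 2 + φ * C))

end SensorScheduling

end

/-!
For one realization of the vectors `a_i`, the Sherman–Morrison formula gives
`f_i(S) = ‖F⁻¹ a_i‖² / (σ² + a_iᵀ F⁻¹ a_i)` with `F = F_S`. The eigenvalues of every `F_S` lie between
`1 / λ_max(P)` and `λ_max(F_[n]) = 1 / φ`, which bounds each quotient `f_i(T) / f_i(S)` by the stated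
expression; the argument works for any lower bound of `φ` as well (`maxCurvature_objective_le`).
Moreover `λ_max(F_[n]) ≤ 1 / λ_min(P) + σ⁻² λ_max(∑ a_i a_iᵀ)`, so that only the upper tail
`λ_max(∑ a_i a_iᵀ) ≤ n σa² + q` is left (`exists_event_sum_sq_le`).

This is a matrix Bernstein inequality, but one for sums of rank-one matrices, and here the
Laplace transform method needs neither Lieb's theorem nor the general Golden–Thompson inequality. If
`A` is positive semidefinite and `uᵀ u ≤ C`, expanding the powers of `A + u uᵀ` produces products of
numbers `uᵀ A ^ i u`, which Chebyshev's association inequality for the spectral measure of `A` at `u`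
merges into one. Summing the exponential series,
`tr exp (θ (A + u uᵀ)) ≤ tr exp (θ A) + C⁻¹ (exp (θ C) - 1) uᵀ exp (θ A) u`
(`trace_exp_rankOne_update_le`). Averaging over one independent vector with second moment `σa² I`
multiplies the expected trace exponential by at most `1 + (σa² / C) (exp (θ C) - 1)`, the moment
generating function of a variable that is `C` with probability `σa² / C` and `0` otherwise. It has
variance `σa² (C - σa²)` and exceeds its mean by at most `C - σa²`, so the scalar Bernstein argument
(`exists_bernstein_parameter`) yields exactly the claimed failure probability.
-/

namespace SensorScheduling

open Matrix
open Polynomial hiding smul_pow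

/-! ### Spectral measures of symmetric matrices -/

section Spectral

variable {ι : Type*} [Fintype ι] [DecidableEq ι] {A : Matrix ι ι ℝ}

theorem aeval_eq_conj_diagonal (hA : A.IsHermitian) (p : ℝ[X]) :
    aeval A p = (hA.eigenvectorUnitary : Matrix ι ι ℝ) *
      diagonal (fun i => p.eval (hA.eigenvalues i)) *
        star (hA.eigenvectorUnitary : Matrix ι ι ℝ) := by
  have h := Polynomial.aeval_algHom_apply
    (Unitary.conjStarAlgAut ℝ _ hA.eigenvectorUnitary : Matrix ι ι ℝ ≃⋆ₐ[ℝ] Matrix ι ι ℝ)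
    (diagonal (RCLike.ofReal ∘ hA.eigenvalues)) p
  rw [← hA.spectral_theorem, Unitary.conjStarAlgAut_apply] at h
  have h2 : aeval (diagonal (RCLike.ofReal ∘ hA.eigenvalues) : Matrix ι ι ℝ) p =
      diagonal (fun i => p.eval (hA.eigenvalues i)) := by
    have := Polynomial.aeval_algHom_apply (diagonalAlgHom ℝ : (ι → ℝ) →ₐ[ℝ] Matrix ι ι ℝ)
      hA.eigenvalues p
    convert! this using 1
    rw [Polynomial.aeval_pi]
    rfl
  rw [h, h2]

omit [DecidableEq ι] in
theorem dotProduct_mulVec_conj (U D : Matrix ι ι ℝ) (u : ι → ℝ) :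
    u ⬝ᵥ (U * D * star U) *ᵥ u = (star U *ᵥ u) ⬝ᵥ D *ᵥ (star U *ᵥ u) := by
  rw [← mulVec_mulVec, ← mulVec_mulVec, dotProduct_mulVec, star_eq_conjTranspose,
    conjTranspose_eq_transpose_of_trivial, mulVec_transpose]

/-- The spectral measure of a real symmetric matrix `A` at the vector `u`: the weight `c i` is the
square of the `i`-th coordinate of `u` in an eigenbasis of `A`. -/
theorem exists_spectral_weights (hA : A.IsHermitian) (u : ι → ℝ) :
    ∃ c : ι → ℝ, (∀ i, 0 ≤ c i) ∧
      ∀ p : ℝ[X], u ⬝ᵥ aeval A p *ᵥ u = ∑ i, p.eval (hA.eigenvalues i) * c i := by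
  refine ⟨fun i => (star (hA.eigenvectorUnitary : Matrix ι ι ℝ) *ᵥ u) i ^ 2,
    fun i => sq_nonneg _, fun p => ?_⟩
  rw [aeval_eq_conj_diagonal hA, dotProduct_mulVec_conj, dotProduct]
  refine Finset.sum_congr rfl fun i _ => ?_
  rw [mulVec_diagonal]
  ring

theorem trace_aeval_eq_sum (hA : A.IsHermitian) (p : ℝ[X]) :
    (aeval A p).trace = ∑ i, p.eval (hA.eigenvalues i) := by
  rw [aeval_eq_conj_diagonal hA, trace_mul_cycle, Unitary.coe_star_mul_self, one_mul,
    trace_diagonal]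

/-- Chebyshev's association inequality for the spectral measure of `A` at `u`, whose total mass is
`u ⬝ᵥ u`: polynomials that increase on `[0, ∞)` are positively correlated. -/
theorem dotProduct_mulVec_aeval_mul_le (hA : A.PosSemidef) {p q : ℝ[X]}
    (hp : MonotoneOn p.eval (Set.Ici 0)) (hq : MonotoneOn q.eval (Set.Ici 0)) (u : ι → ℝ) :
    (u ⬝ᵥ aeval A p *ᵥ u) * (u ⬝ᵥ aeval A q *ᵥ u) ≤ (u ⬝ᵥ u) * (u ⬝ᵥ aeval A (p * q) *ᵥ u) := by
  obtain ⟨c, hc, h⟩ := exists_spectral_weights hA.isHermitian u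
  have h1 : u ⬝ᵥ u = ∑ i, c i := by simpa using h 1
  rw [h1, h, h, h, Finset.sum_mul_sum, Finset.sum_mul_sum]
  set x := hA.isHermitian.eigenvalues
  have hx : ∀ i, x i ∈ Set.Ici (0 : ℝ) := hA.eigenvalues_nonneg
  -- Symmetrize the double sum: both differences have the same sign.
  have key : 0 ≤ ∑ i, ∑ j, (p.eval (x i) - p.eval (x j)) * (q.eval (x i) - q.eval (x j)) *
      (c i * c j) := by
    refine Finset.sum_nonneg fun i _ => Finset.sum_nonneg fun j _ =>
      mul_nonneg ?_ (mul_nonneg (hc i) (hc j))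
    rcases le_total (x i) (x j) with hij | hij
    · exact mul_nonneg_of_nonpos_of_nonpos (sub_nonpos.2 (hp (hx i) (hx j) hij))
        (sub_nonpos.2 (hq (hx i) (hx j) hij))
    · exact mul_nonneg (sub_nonneg.2 (hp (hx j) (hx i) hij))
        (sub_nonneg.2 (hq (hx j) (hx i) hij))
  have e : ∑ i, ∑ j, (p.eval (x i) - p.eval (x j)) * (q.eval (x i) - q.eval (x j)) *
      (c i * c j) = 2 * (∑ i, ∑ j, c i * ((p * q).eval (x j) * c j)) -
        2 * ∑ i, ∑ j, p.eval (x i) * c i * (q.eval (x j) * c j) := by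
    have s1 : ∑ i, ∑ j, c i * ((p * q).eval (x j) * c j) =
        ∑ i, ∑ j, c j * ((p * q).eval (x i) * c i) := Finset.sum_comm
    have s2 : ∑ i, ∑ j, p.eval (x i) * c i * (q.eval (x j) * c j) =
        ∑ i, ∑ j, p.eval (x j) * c j * (q.eval (x i) * c i) := Finset.sum_comm
    rw [two_mul, two_mul]
    nth_rewrite 2 [s1]
    nth_rewrite 2 [s2]
    simp only [← Finset.sum_add_distrib, ← Finset.sum_sub_distrib, eval_mul]
    exact Finset.sum_congr rfl fun i _ => Finset.sum_congr rfl fun j _ => by ring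
  linarith

end Spectral

/-! ### Traces of powers under rank-one perturbations -/

section RankOne

variable {ι : Type*} [Fintype ι] [DecidableEq ι] {A : Matrix ι ι ℝ}

theorem dotProduct_mulVec_aeval_nonneg (hA : A.PosSemidef) {p : ℝ[X]}
    (hp : ∀ x, 0 ≤ x → 0 ≤ p.eval x) (u : ι → ℝ) : 0 ≤ u ⬝ᵥ aeval A p *ᵥ u := by
  obtain ⟨c, hc, h⟩ := exists_spectral_weights hA.isHermitian u
  rw [h]
  exact Finset.sum_nonneg fun i _ => mul_nonneg (hp _ (hA.eigenvalues_nonneg i)) (hc i)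

omit [DecidableEq ι] in
theorem mul_vecMulVec_mul_quadratic (B D : Matrix ι ι ℝ) (u : ι → ℝ) :
    u ⬝ᵥ (B * vecMulVec u u * D) *ᵥ u = (u ⬝ᵥ B *ᵥ u) * (u ⬝ᵥ D *ᵥ u) := by
  rw [← mulVec_mulVec, ← mulVec_mulVec, vecMulVec_mulVec]
  simp [mulVec_smul, mul_comm]

theorem monotoneOn_eval_shift {C : ℝ} (hC : 0 ≤ C) (k j : ℕ) :
    MonotoneOn ((X + Polynomial.C C) ^ k * X ^ j : ℝ[X]).eval (Set.Ici 0) := by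
  intro x (hx : 0 ≤ x) y _ hxy
  have hy : 0 ≤ y + C := by linarith
  simp only [eval_mul, eval_pow, eval_add, eval_X, eval_C]
  gcongr

/-- Seen from `u`, the perturbation `u uᵀ` of `A` acts no more strongly than the scalar perturbation
`C ≥ u ⬝ᵥ u`. Replacing one factor `A + u uᵀ` at a time splits the quadratic form at `u uᵀ` into a
product of two quadratic forms, which Chebyshev's inequality puts back together. -/
theorem dotProduct_pow_mul_pow_le (hA : A.PosSemidef) {u : ι → ℝ} {C : ℝ} (hu : u ⬝ᵥ u ≤ C)
    (k j : ℕ) :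
    u ⬝ᵥ ((A + vecMulVec u u) ^ k * A ^ j) *ᵥ u ≤
      u ⬝ᵥ aeval A ((X + Polynomial.C C) ^ k * X ^ j : ℝ[X]) *ᵥ u := by
  have hu0 : 0 ≤ u ⬝ᵥ u := Finset.sum_nonneg fun i _ => mul_self_nonneg (u i)
  have hC : 0 ≤ C := hu0.trans hu
  have hnn : ∀ k j, 0 ≤ u ⬝ᵥ aeval A ((X + Polynomial.C C) ^ k * X ^ j : ℝ[X]) *ᵥ u := by
    intro k j
    refine dotProduct_mulVec_aeval_nonneg hA (fun x hx => ?_) u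
    simp only [eval_mul, eval_pow, eval_add, eval_X, eval_C]
    positivity
  induction k generalizing j with
  | zero => simp
  | succ k ih =>
    have e1 : (A + vecMulVec u u) ^ (k + 1) * A ^ j =
        (A + vecMulVec u u) ^ k * A ^ (j + 1) +
          (A + vecMulVec u u) ^ k * vecMulVec u u * A ^ j := by
      rw [pow_succ, pow_succ' A]; noncomm_ring
    have e2 : ((X + Polynomial.C C) ^ (k + 1) * X ^ j : ℝ[X]) =
        (X + Polynomial.C C) ^ k * X ^ (j + 1) +
          Polynomial.C C * ((X + Polynomial.C C) ^ k * X ^ j) := by ring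
    rw [e1, e2, map_add, add_mulVec, add_mulVec, dotProduct_add, dotProduct_add,
      mul_vecMulVec_mul_quadratic]
    refine add_le_add (ih (j + 1)) ?_
    have h0 := ih 0
    rw [pow_zero, mul_one] at h0
    have hj : u ⬝ᵥ A ^ j *ᵥ u = u ⬝ᵥ aeval A ((X + Polynomial.C C) ^ 0 * X ^ j : ℝ[X]) *ᵥ u := by
      simp
    calc _ ≤ (u ⬝ᵥ aeval A ((X + Polynomial.C C) ^ k * X ^ 0 : ℝ[X]) *ᵥ u) *
          (u ⬝ᵥ aeval A ((X + Polynomial.C C) ^ 0 * X ^ j : ℝ[X]) *ᵥ u) := by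
          rw [hj]; exact mul_le_mul_of_nonneg_right h0 (hnn 0 j)
      _ ≤ (u ⬝ᵥ u) * (u ⬝ᵥ aeval A ((X + Polynomial.C C) ^ k * X ^ 0 *
          ((X + Polynomial.C C) ^ 0 * X ^ j) : ℝ[X]) *ᵥ u) :=
          dotProduct_mulVec_aeval_mul_le hA (monotoneOn_eval_shift hC k 0)
            (monotoneOn_eval_shift hC 0 j) u
      _ ≤ C * (u ⬝ᵥ aeval A ((X + Polynomial.C C) ^ k * X ^ j : ℝ[X]) *ᵥ u) := by
          rw [pow_zero, pow_zero, mul_one, one_mul]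
          exact mul_le_mul_of_nonneg_right hu (hnn k j)
      _ = _ := by
          rw [map_mul (aeval A) (Polynomial.C C), aeval_C, Algebra.algebraMap_eq_smul_one,
            smul_mul_assoc, one_mul, smul_mulVec, dotProduct_smul, smul_eq_mul]

omit [DecidableEq ι] in
theorem trace_mul_vecMulVec_mul (B D : Matrix ι ι ℝ) (u : ι → ℝ) :
    (B * vecMulVec u u * D).trace = u ⬝ᵥ (D * B) *ᵥ u := by
  rw [trace_mul_cycle, mul_vecMulVec, trace_vecMulVec, dotProduct_comm]

/-- If `C > 0`, this bounds the increase of `tr A ^ k` by `u ⬝ᵥ p(A) u` with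
`p(x) = ((x + C) ^ k - x ^ k) / C`, a polynomial in `A` alone; it is sharp when `A` is scalar and
`u ⬝ᵥ u = C`. -/
theorem trace_pow_rankOne_update_le (hA : A.PosSemidef) {u : ι → ℝ} {C : ℝ} (hu : u ⬝ᵥ u ≤ C)
    (k : ℕ) :
    C * (((A + vecMulVec u u) ^ k).trace - (A ^ k).trace) ≤
      u ⬝ᵥ ((A + C • (1 : Matrix ι ι ℝ)) ^ k - A ^ k) *ᵥ u := by
  have hu0 : 0 ≤ u ⬝ᵥ u := Finset.sum_nonneg fun i _ => mul_self_nonneg (u i)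
  have hC : 0 ≤ C := hu0.trans hu
  set M := A + vecMulVec u u with hM
  -- Powers of `A` stay on the left, so that taking the trace gathers `M ^ i * A ^ (k - 1 - i)`.
  have tele : ∀ k, M ^ k - A ^ k =
      ∑ i ∈ Finset.range k, A ^ (k - 1 - i) * vecMulVec u u * M ^ i := by
    intro k
    induction k with
    | zero => simp
    | succ k ih =>
      rw [Finset.sum_range_succ]
      have : ∀ i ∈ Finset.range k, A ^ (k + 1 - 1 - i) * vecMulVec u u * M ^ i =
          A * (A ^ (k - 1 - i) * vecMulVec u u * M ^ i) := by
        intro i hi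
        rw [Finset.mem_range] at hi
        rw [show k + 1 - 1 - i = (k - 1 - i) + 1 by omega, pow_succ']
        simp only [mul_assoc]
      rw [Finset.sum_congr rfl this, ← Finset.mul_sum, ← ih, pow_succ', pow_succ',
        show k + 1 - 1 - k = 0 by omega, pow_zero, one_mul]
      nth_rewrite 1 [hM]
      noncomm_ring
  have hpoly : (A + C • (1 : Matrix ι ι ℝ)) ^ k - A ^ k =
      C • ∑ i ∈ Finset.range k, aeval A ((X + Polynomial.C C) ^ i * X ^ (k - 1 - i) : ℝ[X]) := by
    have h := geom_sum₂_mul (X + Polynomial.C C : ℝ[X]) X k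
    have h' := congrArg (aeval A) h
    simp only [map_sub, map_mul, map_sum, add_sub_cancel_left] at h'
    simp only [map_pow, map_add, aeval_X, aeval_C, Algebra.algebraMap_eq_smul_one, map_mul] at h' ⊢
    rw [← h', mul_smul_comm, mul_one]
  rw [← trace_sub, tele, hpoly, trace_sum, smul_mulVec, dotProduct_smul, smul_eq_mul, sum_mulVec,
    dotProduct_sum]
  refine mul_le_mul_of_nonneg_left (Finset.sum_le_sum fun i _ => ?_) hC
  rw [trace_mul_vecMulVec_mul]
  exact dotProduct_pow_mul_pow_le hA hu i _

end RankOne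

/-! ### Trace exponentials -/

section Exponential

variable {ι : Type*} [Fintype ι] [DecidableEq ι] {A : Matrix ι ι ℝ}

theorem hasSum_matrix_exp (A : Matrix ι ι ℝ) :
    HasSum (fun k : ℕ => ((k.factorial : ℝ)⁻¹) • A ^ k) (NormedSpace.exp A) := by
  let : SeminormedRing (Matrix ι ι ℝ) := Matrix.linftyOpSemiNormedRing
  let : NormedRing (Matrix ι ι ℝ) := Matrix.linftyOpNormedRing
  let : NormedAlgebra ℝ (Matrix ι ι ℝ) := Matrix.linftyOpNormedAlgebra
  exact NormedSpace.exp_series_hasSum_exp' (𝕂 := ℝ) A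

theorem continuous_matrix_exp :
    Continuous (NormedSpace.exp : Matrix ι ι ℝ → Matrix ι ι ℝ) := by
  let : SeminormedRing (Matrix ι ι ℝ) := Matrix.linftyOpSemiNormedRing
  let : NormedRing (Matrix ι ι ℝ) := Matrix.linftyOpNormedRing
  let : NormedAlgebra ℝ (Matrix ι ι ℝ) := Matrix.linftyOpNormedAlgebra
  let : NormedAlgebra ℚ (Matrix ι ι ℝ) := .restrictScalars ℚ ℝ _
  exact NormedSpace.exp_continuous (𝔸 := Matrix ι ι ℝ)

theorem hasSum_trace_exp (A : Matrix ι ι ℝ) (θ : ℝ) :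
    HasSum (fun k : ℕ => θ ^ k / k.factorial * (A ^ k).trace)
      (NormedSpace.exp (θ • A)).trace := by
  convert! (hasSum_matrix_exp (θ • A)).map (traceAddMonoidHom ι ℝ)
    (by exact continuous_id.matrix_trace) using 1
  ext k
  simp [smul_pow, trace_smul, div_eq_inv_mul, mul_assoc]

theorem hasSum_dotProduct_exp (A : Matrix ι ι ℝ) (θ : ℝ) (u : ι → ℝ) :
    HasSum (fun k : ℕ => θ ^ k / k.factorial * (u ⬝ᵥ A ^ k *ᵥ u))
      (u ⬝ᵥ NormedSpace.exp (θ • A) *ᵥ u) := by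
  let L : Matrix ι ι ℝ →+ ℝ :=
    { toFun := fun B => u ⬝ᵥ B *ᵥ u
      map_zero' := by simp
      map_add' := fun B D => by rw [add_mulVec, dotProduct_add] }
  have hL : Continuous L :=
    continuous_const.dotProduct (continuous_id.matrix_mulVec continuous_const)
  convert! (hasSum_matrix_exp (θ • A)).map L hL using 1
  ext k
  simp [L, smul_pow, smul_mulVec, div_eq_inv_mul, mul_assoc]

theorem exp_add_smul_one (A : Matrix ι ι ℝ) (θ C : ℝ) :
    NormedSpace.exp (θ • (A + C • (1 : Matrix ι ι ℝ))) =
      Real.exp (θ * C) • NormedSpace.exp (θ • A) := by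
  rw [smul_add, Matrix.exp_add_of_commute _ _
    (((Commute.one_right A).smul_right C).smul_left θ |>.smul_right θ)]
  have : (θ • C • (1 : Matrix ι ι ℝ)) = diagonal fun _ => θ * C := by
    rw [smul_smul, smul_one_eq_diagonal]
  rw [this, Matrix.exp_diagonal]
  have h2 : NormedSpace.exp (fun _ : ι => θ * C) = fun _ => Real.exp (θ * C) := by
    ext i
    rw [Pi.coe_exp, Real.exp_eq_exp_ℝ]
  rw [h2, ← smul_one_eq_diagonal, mul_smul_comm, mul_one]

/-- The rank-one case of the Golden–Thompson inequality
`tr exp (A + B) ≤ tr (exp A * exp B)`, with `u ⬝ᵥ u` replaced by an upper bound `C`. It follows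
from the bound for powers by summing the exponential series. -/
theorem trace_exp_rankOne_update_le (hA : A.PosSemidef) {u : ι → ℝ} {C θ : ℝ} (hu : u ⬝ᵥ u ≤ C)
    (hθ : 0 ≤ θ) :
    C * ((NormedSpace.exp (θ • (A + vecMulVec u u))).trace - (NormedSpace.exp (θ • A)).trace) ≤
      (Real.exp (θ * C) - 1) * (u ⬝ᵥ NormedSpace.exp (θ • A) *ᵥ u) := by
  have h1 := ((hasSum_trace_exp (A + vecMulVec u u) θ).sub (hasSum_trace_exp A θ)).mul_left C
  have h2 := (hasSum_dotProduct_exp (A + C • (1 : Matrix ι ι ℝ)) θ u).sub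
    (hasSum_dotProduct_exp A θ u)
  rw [exp_add_smul_one, smul_mulVec, dotProduct_smul, smul_eq_mul] at h2
  rw [sub_mul, one_mul]
  refine hasSum_le (fun k => ?_) h1 h2
  have h := trace_pow_rankOne_update_le hA hu k
  rw [sub_mulVec, dotProduct_sub] at h
  have := mul_le_mul_of_nonneg_left h (show 0 ≤ θ ^ k / (k.factorial : ℝ) by positivity)
  linarith

theorem exp_eigenvalue_le_trace_exp (hA : A.PosSemidef) {θ : ℝ} (hθ : 0 ≤ θ) (i : ι) :
    Real.exp (θ * hA.isHermitian.eigenvalues i) ≤ (NormedSpace.exp (θ • A)).trace := by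
  have h1 : HasSum (fun k : ℕ => (θ * hA.isHermitian.eigenvalues i) ^ k / (k.factorial : ℝ))
      (Real.exp (θ * hA.isHermitian.eigenvalues i)) := by
    rw [Real.exp_eq_exp_ℝ]
    exact NormedSpace.expSeries_div_hasSum_exp _
  refine hasSum_le (fun k => ?_) h1 (hasSum_trace_exp A θ)
  have h := trace_aeval_eq_sum hA.isHermitian (X ^ k : ℝ[X])
  simp only [map_pow, aeval_X, eval_pow, eval_X] at h
  rw [h, mul_pow, mul_div_right_comm]
  refine mul_le_mul_of_nonneg_left ?_ (by positivity)
  exact Finset.single_le_sum (f := fun j => hA.isHermitian.eigenvalues j ^ k)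
    (fun j _ => pow_nonneg (hA.eigenvalues_nonneg j) k) (Finset.mem_univ i)

end Exponential

/-! ### Extreme eigenvalues -/

section ExtremeEigenvalues

variable {m : ℕ} {A : Matrix (Fin m) (Fin m) ℝ}

theorem eigenvalues_le_lamMax (hA : A.IsHermitian) (i : Fin m) :
    hA.eigenvalues i ≤ lamMax A :=
  le_csSup A.finite_real_spectrum.bddAbove (hA.eigenvalues_mem_spectrum_real i)

theorem lamMin_le_eigenvalues (hA : A.IsHermitian) (i : Fin m) :
    lamMin A ≤ hA.eigenvalues i :=
  csInf_le A.finite_real_spectrum.bddBelow (hA.eigenvalues_mem_spectrum_real i)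

theorem exists_eigenvalues_eq_lamMax (hm : 0 < m) (hA : A.IsHermitian) :
    ∃ i, hA.eigenvalues i = lamMax A := by
  have hne : (spectrum ℝ A).Nonempty := ⟨_, hA.eigenvalues_mem_spectrum_real ⟨0, hm⟩⟩
  have h := hne.csSup_mem A.finite_real_spectrum
  exact (Set.ext_iff.1 hA.spectrum_real_eq_range_eigenvalues _).1 h

theorem exists_eigenvalues_eq_lamMin (hm : 0 < m) (hA : A.IsHermitian) :
    ∃ i, hA.eigenvalues i = lamMin A := by
  have hne : (spectrum ℝ A).Nonempty := ⟨_, hA.eigenvalues_mem_spectrum_real ⟨0, hm⟩⟩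
  have h := hne.csInf_mem A.finite_real_spectrum
  exact (Set.ext_iff.1 hA.spectrum_real_eq_range_eigenvalues _).1 h

end ExtremeEigenvalues

/-! ### Quadratic forms and inverses -/

section QuadraticForm

variable {ι : Type*} [Fintype ι] [DecidableEq ι] {A : Matrix ι ι ℝ}

theorem exists_eigenvector (hA : A.IsHermitian) (i : ι) :
    ∃ v : ι → ℝ, v ⬝ᵥ v = 1 ∧ v ⬝ᵥ A *ᵥ v = hA.eigenvalues i := by
  have h1 : ((hA.eigenvectorBasis i).ofLp ⬝ᵥ (hA.eigenvectorBasis i).ofLp : ℝ) = 1 := by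
    have := real_inner_self_eq_norm_sq (hA.eigenvectorBasis i)
    rw [hA.eigenvectorBasis.orthonormal.1 i, EuclideanSpace.inner_eq_star_dotProduct] at this
    simpa using this
  refine ⟨(hA.eigenvectorBasis i).ofLp, h1, ?_⟩
  rw [hA.mulVec_eigenvectorBasis, dotProduct_smul, h1, smul_eq_mul, mul_one]

theorem dotProduct_mulVec_le_of_eigenvalues_le (hA : A.IsHermitian) {β : ℝ}
    (h : ∀ i, hA.eigenvalues i ≤ β) (x : ι → ℝ) : x ⬝ᵥ A *ᵥ x ≤ β * (x ⬝ᵥ x) := by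
  obtain ⟨c, hc, hp⟩ := exists_spectral_weights hA x
  have h0 := hp 1
  have h1 := hp Polynomial.X
  simp only [map_one, one_mulVec, Polynomial.eval_one, one_mul, Polynomial.aeval_X,
    Polynomial.eval_X] at h0 h1
  rw [h0, h1, Finset.mul_sum]
  exact Finset.sum_le_sum fun i _ => mul_le_mul_of_nonneg_right (h i) (hc i)

/-- If the eigenvalues of `A` lie in `[α, β]`, the quadratic forms of `A⁻¹` and of `A⁻²` lie within
the bounds that these eigenvalues suggest. All of them are integrals against the spectral measure
of `A` at `A⁻¹ x`. -/
theorem inv_dotProduct_bounds (hA : A.PosDef) {α β : ℝ} (hα : 0 < α) (hβ : 0 < β)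
    (hl : ∀ i, α ≤ hA.isHermitian.eigenvalues i) (hu : ∀ i, hA.isHermitian.eigenvalues i ≤ β)
    (x : ι → ℝ) :
    β⁻¹ * (x ⬝ᵥ x) ≤ x ⬝ᵥ A⁻¹ *ᵥ x ∧ x ⬝ᵥ A⁻¹ *ᵥ x ≤ α⁻¹ * (x ⬝ᵥ x) ∧
      β⁻¹ ^ 2 * (x ⬝ᵥ x) ≤ (A⁻¹ *ᵥ x) ⬝ᵥ A⁻¹ *ᵥ x ∧
      (A⁻¹ *ᵥ x) ⬝ᵥ A⁻¹ *ᵥ x ≤ α⁻¹ ^ 2 * (x ⬝ᵥ x) := by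
  set y := A⁻¹ *ᵥ x with hy
  have hx : x = A *ᵥ y := by
    rw [hy, mulVec_mulVec, Matrix.mul_nonsing_inv _ ((isUnit_iff_isUnit_det _).1 hA.isUnit),
      one_mulVec]
  obtain ⟨c, hc, hp⟩ := exists_spectral_weights hA.isHermitian y
  set l := hA.isHermitian.eigenvalues
  have h0 := hp 1
  have h1 := hp Polynomial.X
  have h2 := hp (Polynomial.X ^ 2)
  have hsymm : Aᵀ = A := by
    simpa [conjTranspose_eq_transpose_of_trivial] using hA.isHermitian.eq
  simp only [map_one, one_mulVec, Polynomial.eval_one, one_mul, Polynomial.aeval_X,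
    Polynomial.eval_X, map_pow, Polynomial.eval_pow] at h0 h1 h2
  have hxy : x ⬝ᵥ y = ∑ i, l i * c i := by rw [hx, dotProduct_comm, h1]
  have hxx : x ⬝ᵥ x = ∑ i, l i ^ 2 * c i := by
    rw [← h2, hx, pow_two, ← mulVec_mulVec, dotProduct_mulVec y, ← mulVec_transpose, hsymm]
  have hpos : ∀ i, 0 < l i := fun i => hα.trans_le (hl i)
  simp only [hxx, hxy, h0, Finset.mul_sum]
  have e1 : ∀ i, β⁻¹ * l i ≤ 1 := fun i => by
    rw [inv_mul_le_iff₀ hβ, mul_one]; exact hu i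
  have e2 : ∀ i, 1 ≤ α⁻¹ * l i := fun i => by
    rw [le_inv_mul_iff₀ hα, mul_one]; exact hl i
  refine ⟨Finset.sum_le_sum fun i _ => ?_, Finset.sum_le_sum fun i _ => ?_,
    Finset.sum_le_sum fun i _ => ?_, Finset.sum_le_sum fun i _ => ?_⟩
  · have := mul_le_mul_of_nonneg_right (e1 i) (mul_nonneg (hpos i).le (hc i))
    linarith
  · have := mul_le_mul_of_nonneg_right (e2 i) (mul_nonneg (hpos i).le (hc i))
    linarith
  · have h := pow_le_one₀ (n := 2) (by have := hpos i; positivity) (e1 i)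
    have := mul_le_mul_of_nonneg_right h (hc i)
    linarith
  · have h := one_le_pow₀ (n := 2) (e2 i)
    have := mul_le_mul_of_nonneg_right h (hc i)
    linarith

omit [DecidableEq ι] in
theorem dotProduct_vecMulVec_mulVec (u x : ι → ℝ) :
    x ⬝ᵥ vecMulVec u u *ᵥ x = (u ⬝ᵥ x) ^ 2 := by
  rw [vecMulVec_mulVec, dotProduct_smul, dotProduct_comm x u]
  simp [pow_two]

/-- The Sherman–Morrison formula. -/
theorem inv_rankOne_update (hA : A.PosDef) {σ : ℝ} (hσ : 0 < σ) (u : ι → ℝ) :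
    (A + (σ ^ 2)⁻¹ • vecMulVec u u)⁻¹ =
      A⁻¹ - (σ ^ 2 + u ⬝ᵥ A⁻¹ *ᵥ u)⁻¹ • vecMulVec (A⁻¹ *ᵥ u) (A⁻¹ *ᵥ u) := by
  have hd : 0 ≤ u ⬝ᵥ A⁻¹ *ᵥ u := by
    simpa using hA.inv.posSemidef.dotProduct_mulVec_nonneg u
  have hsymm : (A⁻¹)ᵀ = A⁻¹ := by
    simpa [conjTranspose_eq_transpose_of_trivial] using hA.inv.isHermitian.eq
  have hdet := (isUnit_iff_isUnit_det _).1 hA.isUnit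
  apply Matrix.inv_eq_right_inv
  have hy : u ᵥ* A⁻¹ = A⁻¹ *ᵥ u := by rw [← mulVec_transpose, hsymm]
  rw [mul_sub, add_mul, add_mul, Matrix.mul_nonsing_inv _ hdet, smul_mul_assoc, vecMulVec_mul, hy,
    mul_smul_comm, mul_smul_comm, mul_vecMulVec, mulVec_mulVec, Matrix.mul_nonsing_inv _ hdet,
    one_mulVec, smul_mul_assoc, vecMulVec_mul_vecMulVec, vecMulVec_smul]
  have hs : σ ^ 2 + u ⬝ᵥ A⁻¹ *ᵥ u ≠ 0 := by positivity
  have hk : (σ ^ 2)⁻¹ - (σ ^ 2 + u ⬝ᵥ A⁻¹ *ᵥ u)⁻¹ -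
      (σ ^ 2 + u ⬝ᵥ A⁻¹ *ᵥ u)⁻¹ * ((σ ^ 2)⁻¹ * (u ⬝ᵥ A⁻¹ *ᵥ u)) = 0 := by
    field_simp
    ring
  ext i j
  simp only [Matrix.add_apply, Matrix.sub_apply, Matrix.smul_apply, smul_eq_mul]
  linear_combination (vecMulVec u (A⁻¹ *ᵥ u) i j) * hk

theorem trace_inv_sub_trace_inv_rankOne_update (hA : A.PosDef) {σ : ℝ} (hσ : 0 < σ)
    (u : ι → ℝ) :
    A⁻¹.trace - (A + (σ ^ 2)⁻¹ • vecMulVec u u)⁻¹.trace =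
      ((A⁻¹ *ᵥ u) ⬝ᵥ A⁻¹ *ᵥ u) / (σ ^ 2 + u ⬝ᵥ A⁻¹ *ᵥ u) := by
  rw [inv_rankOne_update hA hσ, trace_sub, trace_smul, trace_vecMulVec, smul_eq_mul,
    div_eq_inv_mul, sub_sub_cancel]

end QuadraticForm

/-! ### Element-wise curvature of the objective -/

section Curvature

variable {m n : ℕ} {σ : ℝ} {P : Matrix (Fin m) (Fin m) ℝ} {a : Fin n → EuclideanSpace ℝ (Fin m)}

theorem dotProduct_self_eq_norm_sq (v : EuclideanSpace ℝ (Fin m)) : v.ofLp ⬝ᵥ v.ofLp = ‖v‖ ^ 2 := by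
  rw [← real_inner_self_eq_norm_sq, EuclideanSpace.inner_eq_star_dotProduct]
  simp

theorem posSemidef_sum_vecMulVec (a : Fin n → EuclideanSpace ℝ (Fin m)) (S : Finset (Fin n)) :
    (∑ i ∈ S, vecMulVec (a i).ofLp (a i).ofLp).PosSemidef :=
  posSemidef_sum _ fun i _ => by simpa using posSemidef_vecMulVec_self_star (a i).ofLp

theorem fisher_posDef (hP : P.PosDef) (hσ : 0 < σ) (S : Finset (Fin n)) :
    (fisher σ P a S).PosDef :=
  hP.inv.add_posSemidef ((posSemidef_sum_vecMulVec a S).smul (by positivity))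

theorem dotProduct_fisher_mulVec (S : Finset (Fin n)) (x : Fin m → ℝ) :
    x ⬝ᵥ fisher σ P a S *ᵥ x =
      x ⬝ᵥ P⁻¹ *ᵥ x + (σ ^ 2)⁻¹ * ∑ i ∈ S, ((a i).ofLp ⬝ᵥ x) ^ 2 := by
  rw [fisher, add_mulVec, dotProduct_add, smul_mulVec, dotProduct_smul, smul_eq_mul, sum_mulVec,
    dotProduct_sum]
  simp only [dotProduct_vecMulVec_mulVec]

theorem fisher_insert {S : Finset (Fin n)} {i : Fin n} (hi : i ∉ S) :
    fisher σ P a (insert i S) =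
      fisher σ P a S + (σ ^ 2)⁻¹ • vecMulVec (a i).ofLp (a i).ofLp := by
  rw [fisher, fisher, Finset.sum_insert hi, smul_add]
  abel

/-- By the Sherman–Morrison formula, with `F = F_S`, the marginal value of the sensor `i` is
`‖F⁻¹ a_i‖² / (σ² + a_iᵀ F⁻¹ a_i)`. -/
theorem marginal_objective (hP : P.PosDef) (hσ : 0 < σ) {S : Finset (Fin n)} {i : Fin n}
    (hi : i ∉ S) :
    marginal (objective σ P a) i S =
      (((fisher σ P a S)⁻¹ *ᵥ (a i).ofLp) ⬝ᵥ (fisher σ P a S)⁻¹ *ᵥ (a i).ofLp) /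
        (σ ^ 2 + (a i).ofLp ⬝ᵥ (fisher σ P a S)⁻¹ *ᵥ (a i).ofLp) := by
  rw [← trace_inv_sub_trace_inv_rankOne_update (fisher_posDef hP hσ S) hσ, ← fisher_insert hi,
    marginal, objective, objective, trace_sub, trace_sub]
  ring

theorem lamMin_pos (hm : 0 < m) (hP : P.PosDef) : 0 < lamMin P := by
  obtain ⟨i, hi⟩ := exists_eigenvalues_eq_lamMin hm hP.isHermitian
  exact hi ▸ hP.eigenvalues_pos i

theorem lamMax_pos (hm : 0 < m) (hP : P.PosDef) : 0 < lamMax P := by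
  obtain ⟨i, hi⟩ := exists_eigenvalues_eq_lamMax hm hP.isHermitian
  exact hi ▸ hP.eigenvalues_pos i

theorem inv_lamMax_le_eigenvalues_fisher (hm : 0 < m) (hP : P.PosDef) (hσ : 0 < σ)
    (S : Finset (Fin n)) (i : Fin m) :
    (lamMax P)⁻¹ ≤ (fisher_posDef (a := a) hP hσ S).isHermitian.eigenvalues i := by
  obtain ⟨v, hv, hvi⟩ := exists_eigenvector (fisher_posDef (a := a) hP hσ S).isHermitian i
  have h := (inv_dotProduct_bounds hP (lamMin_pos hm hP) (lamMax_pos hm hP)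
    (lamMin_le_eigenvalues _) (eigenvalues_le_lamMax _) v).1
  rw [← hvi, dotProduct_fisher_mulVec]
  rw [hv, mul_one] at h
  have : 0 ≤ (σ ^ 2)⁻¹ * ∑ i ∈ S, ((a i).ofLp ⬝ᵥ v) ^ 2 :=
    mul_nonneg (by positivity) (Finset.sum_nonneg fun i _ => sq_nonneg _)
  linarith

theorem eigenvalues_fisher_le_lamMax_univ (hP : P.PosDef) (hσ : 0 < σ)
    (S : Finset (Fin n)) (i : Fin m) :
    (fisher_posDef (a := a) hP hσ S).isHermitian.eigenvalues i ≤
      lamMax (fisher σ P a Finset.univ) := by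
  obtain ⟨v, hv, hvi⟩ := exists_eigenvector (fisher_posDef (a := a) hP hσ S).isHermitian i
  have h := dotProduct_mulVec_le_of_eigenvalues_le
    (fisher_posDef (a := a) hP hσ Finset.univ).isHermitian (eigenvalues_le_lamMax _) v
  rw [hv, mul_one] at h
  refine hvi ▸ le_trans ?_ h
  rw [dotProduct_fisher_mulVec, dotProduct_fisher_mulVec]
  gcongr
  exact Finset.subset_univ S

theorem lamMax_fisher_le (hm : 0 < m) (hP : P.PosDef) (hσ : 0 < σ) {L : ℝ}
    (hL : ∀ x : Fin m → ℝ, ∑ i, ((a i).ofLp ⬝ᵥ x) ^ 2 ≤ L * (x ⬝ᵥ x)) :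
    lamMax (fisher σ P a Finset.univ) ≤ 1 / lamMin P + L / σ ^ 2 := by
  obtain ⟨i, hi⟩ := exists_eigenvalues_eq_lamMax hm
    (fisher_posDef (a := a) hP hσ Finset.univ).isHermitian
  obtain ⟨v, hv, hvi⟩ := exists_eigenvector (fisher_posDef (a := a) hP hσ _).isHermitian i
  have h := (inv_dotProduct_bounds hP (lamMin_pos hm hP) (lamMax_pos hm hP)
    (lamMin_le_eigenvalues _) (eigenvalues_le_lamMax _) v).2.1
  rw [← hi, ← hvi, dotProduct_fisher_mulVec, one_div, div_eq_inv_mul]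
  have h2 := hL v
  rw [hv, mul_one] at h h2
  gcongr

/-- The eigenvalues of every `F_S` lie in `[1 / λ_max(P), 1 / ψ]`, which bounds the numerators and
the denominators of both marginal values in terms of `‖a_i‖²`; the quotient of the bounds increases
with `‖a_i‖²` because `ψ ≤ λ_max(P)`. The product form also covers `a_i = 0`, where both marginal
values vanish. -/
theorem marginal_le_curvatureBound_mul (hm : 0 < m) (hP : P.PosDef) (hσ : 0 < σ) {C ψ : ℝ}
    (hψ : 0 < ψ) (hψF : ψ ≤ (lamMax (fisher σ P a Finset.univ))⁻¹) {S T : Finset (Fin n)}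
    {i : Fin n} (hS : i ∉ S) (hT : i ∉ T) (hC : ‖a i‖ ^ 2 ≤ C) :
    marginal (objective σ P a) i T ≤
      curvatureBound σ C P ψ * marginal (objective σ P a) i S := by
  have hlam := lamMax_pos hm hP
  have hF := lamMax_pos hm (fisher_posDef (a := a) hP hσ Finset.univ)
  have hFψ : lamMax (fisher σ P a Finset.univ) ≤ ψ⁻¹ := (le_inv_comm₀ hψ hF).1 hψF
  have bounds := fun S => inv_dotProduct_bounds (fisher_posDef (a := a) hP hσ S)
    (inv_pos.2 hlam) (inv_pos.2 hψ) (inv_lamMax_le_eigenvalues_fisher hm hP hσ S)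
    (fun j => (eigenvalues_fisher_le_lamMax_univ hP hσ S j).trans hFψ) (a i).ofLp
  have hψlam : ψ ≤ lamMax P := by
    rw [← inv_le_inv₀ hlam hψ]
    exact (inv_lamMax_le_eigenvalues_fisher hm hP hσ ∅ ⟨0, hm⟩).trans
      ((eigenvalues_fisher_le_lamMax_univ (a := a) hP hσ ∅ ⟨0, hm⟩).trans hFψ)
  rw [marginal_objective hP hσ hS, marginal_objective hP hσ hT]
  obtain ⟨-, s1, s2, -⟩ := bounds S
  obtain ⟨t1, -, -, t2⟩ := bounds T
  rw [dotProduct_self_eq_norm_sq (a i)] at s1 s2 t1 t2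
  rw [inv_inv] at s1 s2 t1 t2
  set s := ‖a i‖ ^ 2
  have hs : 0 ≤ s := sq_nonneg _
  have hC0 : 0 ≤ C := hs.trans hC
  set l := lamMax P
  have hT' : ((fisher σ P a T)⁻¹ *ᵥ (a i).ofLp) ⬝ᵥ (fisher σ P a T)⁻¹ *ᵥ (a i).ofLp /
      (σ ^ 2 + (a i).ofLp ⬝ᵥ (fisher σ P a T)⁻¹ *ᵥ (a i).ofLp) ≤
      l ^ 2 * s / (σ ^ 2 + ψ * s) := by gcongr
  have hd : 0 ≤ (a i).ofLp ⬝ᵥ (fisher σ P a S)⁻¹ *ᵥ (a i).ofLp := by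
    simpa using (fisher_posDef (a := a) hP hσ S).inv.posSemidef.dotProduct_mulVec_nonneg (a i).ofLp
  have hS' : ψ ^ 2 * s / (σ ^ 2 + l * s) ≤
      ((fisher σ P a S)⁻¹ *ᵥ (a i).ofLp) ⬝ᵥ (fisher σ P a S)⁻¹ *ᵥ (a i).ofLp /
      (σ ^ 2 + (a i).ofLp ⬝ᵥ (fisher σ P a S)⁻¹ *ᵥ (a i).ofLp) := by
    have : 0 ≤ ((fisher σ P a S)⁻¹ *ᵥ (a i).ofLp) ⬝ᵥ (fisher σ P a S)⁻¹ *ᵥ (a i).ofLp :=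
      le_trans (by positivity) s2
    gcongr
  have hB : 0 ≤ curvatureBound σ C P ψ := by
    change 0 ≤ l ^ 2 * (σ ^ 2 + l * C) / (ψ ^ 2 * (σ ^ 2 + ψ * C))
    positivity
  refine hT'.trans (le_trans ?_ (mul_le_mul_of_nonneg_left hS' hB))
  change _ ≤ l ^ 2 * (σ ^ 2 + l * C) / (ψ ^ 2 * (σ ^ 2 + ψ * C)) * _
  rw [div_mul_div_comm, div_le_div_iff₀ (by positivity) (by positivity)]
  have key : (σ ^ 2 + l * s) * (σ ^ 2 + ψ * C) ≤ (σ ^ 2 + l * C) * (σ ^ 2 + ψ * s) := by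
    nlinarith [mul_nonneg (mul_nonneg (sub_nonneg.2 hψlam) (sub_nonneg.2 hC)) (sq_nonneg σ)]
  have := mul_le_mul_of_nonneg_left key (show 0 ≤ l ^ 2 * ψ ^ 2 * s by positivity)
  linarith

theorem maxCurvature_objective_le (hm : 0 < m) (hP : P.PosDef) (hσ : 0 < σ) {C ψ : ℝ}
    (hψ : 0 < ψ) (hψF : ψ ≤ (lamMax (fisher σ P a Finset.univ))⁻¹) (hC : ∀ i, ‖a i‖ ^ 2 ≤ C) :
    maxCurvature (objective σ P a) ≤ ENNReal.ofReal (curvatureBound σ C P ψ) := by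
  refine Finset.sup_le fun l _ => iSup₂_le ?_
  rintro ⟨S, T, i⟩ ⟨hST, hiT, -⟩
  dsimp only at hST hiT ⊢
  refine ENNReal.div_le_of_le_mul ?_
  have hC0 : 0 ≤ C := (sq_nonneg _).trans (hC i)
  have hlam := lamMax_pos hm hP
  rw [← ENNReal.ofReal_mul (by rw [curvatureBound]; positivity)]
  exact ENNReal.ofReal_le_ofReal
    (marginal_le_curvatureBound_mul hm hP hσ hψ hψF (fun h => hiT (hST h)) hiT (hC i))

end Curvature

/-! ### Positive definiteness of the Kalman covariances -/

section Kalman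

variable {m n : ℕ}

theorem filteredCov_posSemidef {H Q : ℕ → Matrix (Fin m) (Fin m) ℝ}
    {P₀ : Matrix (Fin m) (Fin m) ℝ} {σ : ℝ} (hQ : ∀ s, (Q s).PosDef) (hP₀ : P₀.PosSemidef)
    (hσ : 0 < σ) (a : ℕ → Fin n → EuclideanSpace ℝ (Fin m)) (S : ℕ → Finset (Fin n)) (t : ℕ) :
    (filteredCov H Q P₀ σ a S t).PosSemidef := by
  induction t with
  | zero => exact hP₀
  | succ t ih =>
    refine (fisher_posDef (PosDef.posSemidef_add ?_ (hQ (t + 1))) hσ _).inv.posSemidef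
    simpa [conjTranspose_eq_transpose_of_trivial] using
      ih.mul_mul_conjTranspose_same (H (t + 1))

theorem predictionCov_posDef {H Q : ℕ → Matrix (Fin m) (Fin m) ℝ}
    {P₀ : Matrix (Fin m) (Fin m) ℝ} {σ : ℝ} (hQ : ∀ s, (Q s).PosDef) (hP₀ : P₀.PosSemidef)
    (hσ : 0 < σ) (a : ℕ → Fin n → EuclideanSpace ℝ (Fin m)) (S : ℕ → Finset (Fin n)) (t : ℕ) :
    (predictionCov H Q P₀ σ a S t).PosDef := by
  refine PosDef.posSemidef_add ?_ (hQ t)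
  simpa [conjTranspose_eq_transpose_of_trivial] using
    (filteredCov_posSemidef hQ hP₀ hσ a S (t - 1)).mul_mul_conjTranspose_same (H t)

end Kalman

/-! ### The scalar Bernstein bound -/

section Scalar

/-- The comparison of the exponential series with a geometric series of ratio `y / 3`, which is where
the `3` in Bernstein's inequality comes from. -/
theorem two_mul_three_pow_le_factorial (k : ℕ) : 2 * 3 ^ k ≤ (k + 2).factorial := by
  induction k with
  | zero => simp
  | succ k ih =>
    rw [show k + 1 + 2 = (k + 2) + 1 by ring, Nat.factorial_succ, pow_succ]
    nlinarith

theorem exp_le_of_lt_three {y : ℝ} (hy : 0 ≤ y) (hy3 : y < 3) :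
    Real.exp y ≤ 1 + y + y ^ 2 / 2 * (1 - y / 3)⁻¹ := by
  have h1 : HasSum (fun k : ℕ => y ^ (k + 2) / ((k + 2).factorial : ℝ)) (Real.exp y - (1 + y)) := by
    have h := NormedSpace.expSeries_div_hasSum_exp y
    rw [← Real.exp_eq_exp_ℝ, ← hasSum_nat_add_iff' 2] at h
    simpa [Finset.sum_range_succ] using h
  have h2 := (hasSum_geometric_of_lt_one (r := y / 3) (by positivity) (by linarith)).mul_left
    (y ^ 2 / 2)
  have := hasSum_le (fun k => ?_) h1 h2
  · linarith
  · have hk : (2 * 3 ^ k : ℝ) ≤ ((k + 2).factorial : ℝ) := by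
      exact_mod_cast two_mul_three_pow_le_factorial k
    rw [div_pow, div_mul_div_comm, ← pow_add, add_comm 2 k]
    gcongr

theorem exp_neg_le_quadratic {y : ℝ} (hy : 0 ≤ y) : Real.exp (-y) ≤ 1 - y + y ^ 2 / 2 := by
  rw [Real.exp_neg]
  have h := Real.quadratic_le_exp_of_nonneg hy
  refine (inv_anti₀ (by positivity) h).trans ?_
  rw [inv_le_iff_one_le_mul₀ (by positivity)]
  nlinarith [sq_nonneg (y ^ 2)]

/-- Bernstein's bound for the moment generating function at `θ` of a random variable that equals
`R + x` with probability `x / (R + x)` and `0` otherwise: it has mean `x` and variance `x * R`, and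
exceeds its mean by at most `R`. -/
theorem two_point_mgf_le {x R θ : ℝ} (hx : 0 ≤ x) (hR : 0 < R) (hθ : 0 ≤ θ) (hθR : θ * R < 3) :
    1 + x / (R + x) * (Real.exp (θ * (R + x)) - 1) ≤
      Real.exp (θ * x + θ ^ 2 * (x * R) / 2 * (1 - θ * R / 3)⁻¹) := by
  set g := (1 - θ * R / 3)⁻¹ with hg
  have hg1 : 1 ≤ g := by
    rw [hg, one_le_inv₀ (by linarith)]
    have : 0 ≤ θ * R := by positivity
    linarith
  have h1 : Real.exp (θ * R) ≤ 1 + θ * R + (θ * R) ^ 2 / 2 * g :=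
    exp_le_of_lt_three (by positivity) hθR
  have h2 : Real.exp (-(θ * x)) ≤ 1 - θ * x + (θ * x) ^ 2 / 2 * g := by
    refine (exp_neg_le_quadratic (by positivity)).trans ?_
    have : (θ * x) ^ 2 / 2 * 1 ≤ (θ * x) ^ 2 / 2 * g := by gcongr
    linarith
  have hC : 0 < R + x := by linarith
  have e : 1 + x / (R + x) * (Real.exp (θ * (R + x)) - 1) = Real.exp (θ * x) *
      (R / (R + x) * Real.exp (-(θ * x)) + x / (R + x) * Real.exp (θ * R)) := by
    rw [mul_add θ, Real.exp_add, Real.exp_neg]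
    field_simp
    ring
  rw [e, Real.exp_add]
  refine mul_le_mul_of_nonneg_left ?_ (Real.exp_nonneg _)
  calc R / (R + x) * Real.exp (-(θ * x)) + x / (R + x) * Real.exp (θ * R)
      ≤ R / (R + x) * (1 - θ * x + (θ * x) ^ 2 / 2 * g) +
        x / (R + x) * (1 + θ * R + (θ * R) ^ 2 / 2 * g) := by gcongr
    _ = θ ^ 2 * (x * R) / 2 * g + 1 := by field_simp; ring
    _ ≤ _ := Real.add_one_le_exp _

/-- The choice of `θ` in the Chernoff bound for a sum of `n` such two-point variables. -/
theorem exists_bernstein_parameter (n : ℕ) {x R q : ℝ} (hx : 0 ≤ x) (hR : 0 < R) (hq : 0 < q) :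
    ∃ θ : ℝ, 0 < θ ∧ (1 + x / (R + x) * (Real.exp (θ * (R + x)) - 1)) ^ n ≤
      Real.exp (θ * (n * x + q) + -(q ^ 2 / 2) / (R * (n * x + q / 3))) := by
  have hn : (0 : ℝ) ≤ n := n.cast_nonneg
  rcases (mul_nonneg hn hx).eq_or_lt with h0 | h0
  -- With zero variance the generic choice of `θ` below is `3 / R`, where Bernstein's bound breaks
  -- down; half of it makes the exponent vanish, and the left-hand side is `1`.
  · refine ⟨3 / (2 * R), by positivity, ?_⟩
    rw [← h0]
    have hexp : 3 / (2 * R) * (0 + q) + -(q ^ 2 / 2) / (R * (0 + q / 3)) = 0 := by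
      field_simp
      ring
    rw [hexp, Real.exp_zero]
    rcases mul_eq_zero.1 h0.symm with h | h
    · rw [Nat.cast_eq_zero.1 h, pow_zero]
    · simp [h]
  · set D := n * x + q / 3 with hD
    have hDpos : 0 < D := by positivity
    have hθR : q / (R * D) * R = q / D := by field_simp
    refine ⟨q / (R * D), by positivity, ?_⟩
    have hlt : q / (R * D) * R < 3 := by
      rw [hθR, div_lt_iff₀ hDpos, hD]; linarith
    refine (pow_le_pow_left₀ ?_ (two_point_mgf_le hx hR (by positivity) hlt) n).trans ?_
    · have : 1 ≤ Real.exp (q / (R * D) * (R + x)) := Real.one_le_exp (by positivity)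
      have : 0 ≤ x / (R + x) * (Real.exp (q / (R * D) * (R + x)) - 1) :=
        mul_nonneg (by positivity) (by linarith)
      linarith
    · rw [← Real.exp_nat_mul]
      refine Real.exp_le_exp.2 (le_of_eq ?_)
      have hg : 1 - q / (R * D) * R / 3 = n * x / D := by
        rw [hθR, hD]; field_simp; ring
      have hxpos : x ≠ 0 := fun h => by simp [h] at h0
      have hnpos : (n : ℝ) ≠ 0 := fun h => by simp [h] at h0
      rw [hg]
      field_simp
      ring

end Scalar

/-! ### The expected trace exponential of a random Gram matrix -/

section Moments

variable {Ω : Type*} [MeasurableSpace Ω] {μ : Measure Ω} [IsProbabilityMeasure μ] {m n : ℕ}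
  {b : Fin n → Ω → EuclideanSpace ℝ (Fin m)} {C : ℝ}

/-- The family `b` almost surely stays in a compact set, so a continuous function of it is bounded. -/
theorem integrable_continuous_comp (hmeas : ∀ j, Measurable (b j))
    (hbound : ∀ j, ∀ᵐ ω ∂μ, ‖b j ω‖ ^ 2 ≤ C) {F : (Fin n → EuclideanSpace ℝ (Fin m)) → ℝ}
    (hF : Continuous F) : Integrable (fun ω => F fun j => b j ω) μ := by
  obtain ⟨K, hK⟩ := (isCompact_closedBall (0 : Fin n → EuclideanSpace ℝ (Fin m))
    (Real.sqrt C)).exists_bound_of_continuousOn hF.continuousOn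
  refine Integrable.of_bound
    (hF.measurable.comp (measurable_pi_lambda _ hmeas)).aestronglyMeasurable K ?_
  filter_upwards [ae_all_iff.2 hbound] with ω hω
  refine hK _ ?_
  rw [mem_closedBall_zero_iff, pi_norm_le_iff_of_nonneg (Real.sqrt_nonneg _)]
  exact fun j => Real.le_sqrt_of_sq_le (hω j)

theorem integral_coord_mul_coord (hmeas : ∀ j, Measurable (b j))
    (hbound : ∀ j, ∀ᵐ ω ∂μ, ‖b j ω‖ ^ 2 ≤ C) (hmean : ∀ j, ∫ ω, b j ω ∂μ = 0) {s : ℝ}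
    (hcov : ∀ j, (Matrix.of fun k l : Fin m => cov[fun ω => b j ω k, fun ω => b j ω l; μ]) =
      s • (1 : Matrix (Fin m) (Fin m) ℝ)) (j : Fin n) (k l : Fin m) :
    ∫ ω, b j ω k * b j ω l ∂μ = if k = l then s else 0 := by
  have hint : Integrable (b j) μ := by
    refine Integrable.of_bound (hmeas j).aestronglyMeasurable (Real.sqrt C) ?_
    filter_upwards [hbound j] with ω hω using Real.le_sqrt_of_sq_le hω
  have h0 : ∀ k, ∫ ω, b j ω k ∂μ = 0 := fun k => by
    have := (EuclideanSpace.proj k : EuclideanSpace ℝ (Fin m) →L[ℝ] ℝ).integral_comp_comm hint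
    simpa [hmean j] using this
  have h := congrFun (congrFun (hcov j) k) l
  rw [Matrix.of_apply, covariance] at h
  simp only [h0, sub_zero, Matrix.smul_apply, Matrix.one_apply, smul_eq_mul, mul_ite, mul_one,
    mul_zero] at h
  exact h

/-- The matrix `∑ i ∈ J, x_i x_iᵀ`, as a function of the whole family of vectors `x`. -/
def gramSum (J : Finset (Fin n)) (x : Fin n → EuclideanSpace ℝ (Fin m)) :
    Matrix (Fin m) (Fin m) ℝ :=
  ∑ i ∈ J, vecMulVec (x i).ofLp (x i).ofLp

theorem continuous_gramSum (J : Finset (Fin n)) :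
    Continuous (gramSum J : (Fin n → EuclideanSpace ℝ (Fin m)) → Matrix (Fin m) (Fin m) ℝ) := by
  refine continuous_finsetSum _ fun i _ => ?_
  have : Continuous fun x : Fin n → EuclideanSpace ℝ (Fin m) => (x i).ofLp := by fun_prop
  exact this.matrix_vecMulVec this

theorem continuous_exp_gramSum (J : Finset (Fin n)) (θ : ℝ) :
    Continuous fun x : Fin n → EuclideanSpace ℝ (Fin m) => NormedSpace.exp (θ • gramSum J x) :=
  continuous_matrix_exp.comp ((continuous_gramSum J).const_smul θ)

theorem gramSum_posSemidef (J : Finset (Fin n)) (x : Fin n → EuclideanSpace ℝ (Fin m)) :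
    (gramSum J x).PosSemidef :=
  posSemidef_sum_vecMulVec x J

omit [IsProbabilityMeasure μ] in
theorem indepFun_coord_mul_exp_gramSum (hmeas : ∀ j, Measurable (b j)) (hindep : iIndepFun b μ)
    {J : Finset (Fin n)} {j : Fin n} (hj : j ∉ J) (θ : ℝ) (k l : Fin m) :
    IndepFun (fun ω => b j ω k * b j ω l)
      (fun ω => NormedSpace.exp (θ • gramSum J fun i => b i ω) k l) μ := by
  have h := hindep.indepFun_finset {j} J (Finset.disjoint_singleton_left.2 hj) hmeas
  have hc1 : Continuous fun x : ({j} : Finset (Fin n)) → EuclideanSpace ℝ (Fin m) =>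
      x ⟨j, Finset.mem_singleton_self j⟩ k * x ⟨j, Finset.mem_singleton_self j⟩ l := by fun_prop
  have hc2 : Continuous fun x : J → EuclideanSpace ℝ (Fin m) =>
      NormedSpace.exp (θ • ∑ i, vecMulVec (x i).ofLp (x i).ofLp) k l := by
    have : Continuous fun x : J → EuclideanSpace ℝ (Fin m) =>
        θ • ∑ i, vecMulVec (x i).ofLp (x i).ofLp := by
      refine (continuous_finsetSum _ fun i _ => ?_).const_smul θ
      have : Continuous fun x : J → EuclideanSpace ℝ (Fin m) => (x i).ofLp := by fun_prop
      exact this.matrix_vecMulVec this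
    exact (continuous_matrix_exp.comp this).matrix_elem k l
  have h2 := h.comp hc1.measurable hc2.measurable
  convert! h2 using 1
  ext ω
  simp only [Function.comp_apply, gramSum]
  rw [Finset.sum_coe_sort J fun i => vecMulVec (b i ω).ofLp (b i ω).ofLp]

theorem integral_quadratic_exp_gramSum (hmeas : ∀ j, Measurable (b j)) (hindep : iIndepFun b μ)
    (hbound : ∀ j, ∀ᵐ ω ∂μ, ‖b j ω‖ ^ 2 ≤ C) {s : ℝ}
    (hmom : ∀ j (k l : Fin m), ∫ ω, b j ω k * b j ω l ∂μ = if k = l then s else 0)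
    {J : Finset (Fin n)} {j : Fin n} (hj : j ∉ J) (θ : ℝ) :
    ∫ ω, (b j ω).ofLp ⬝ᵥ NormedSpace.exp (θ • gramSum J fun i => b i ω) *ᵥ (b j ω).ofLp ∂μ =
      s * ∫ ω, (NormedSpace.exp (θ • gramSum J fun i => b i ω)).trace ∂μ := by
  have hcont : ∀ k l, Continuous fun x : Fin n → EuclideanSpace ℝ (Fin m) =>
      NormedSpace.exp (θ • gramSum J x) k l := fun k l =>
    (continuous_exp_gramSum J θ).matrix_elem k l
  have hcont2 : ∀ k l, Continuous fun x : Fin n → EuclideanSpace ℝ (Fin m) => x j k * x j l :=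
    fun k l => by fun_prop
  have hE : ∀ ω, (b j ω).ofLp ⬝ᵥ NormedSpace.exp (θ • gramSum J fun i => b i ω) *ᵥ (b j ω).ofLp =
      ∑ k, ∑ l, (b j ω k * b j ω l) * NormedSpace.exp (θ • gramSum J fun i => b i ω) k l := by
    intro ω
    simp only [dotProduct, mulVec, Finset.mul_sum]
    exact Finset.sum_congr rfl fun k _ => Finset.sum_congr rfl fun l _ => by ring
  have hint : ∀ k l, Integrable (fun ω => (b j ω k * b j ω l) *
      NormedSpace.exp (θ • gramSum J fun i => b i ω) k l) μ := fun k l =>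
    integrable_continuous_comp hmeas hbound ((hcont2 k l).mul (hcont k l))
  have hmul : ∀ k l, ∫ ω, (b j ω k * b j ω l) *
      NormedSpace.exp (θ • gramSum J fun i => b i ω) k l ∂μ =
      (if k = l then s else 0) *
        ∫ ω, NormedSpace.exp (θ • gramSum J fun i => b i ω) k l ∂μ := fun k l => by
    rw [(indepFun_coord_mul_exp_gramSum hmeas hindep hj θ k l).integral_fun_mul_eq_mul_integral
      (integrable_continuous_comp hmeas hbound (hcont2 k l)).aestronglyMeasurable
      (integrable_continuous_comp hmeas hbound (hcont k l)).aestronglyMeasurable, hmom]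
  simp only [hE, Matrix.trace, Matrix.diag]
  rw [integral_finsetSum _ fun k _ => integrable_finsetSum _ fun l _ => hint k l,
    integral_finsetSum _ fun k _ => integrable_continuous_comp hmeas hbound (hcont k k),
    Finset.mul_sum]
  refine Finset.sum_congr rfl fun k _ => ?_
  rw [integral_finsetSum _ fun l _ => hint k l]
  simp only [hmul, ite_mul, zero_mul, Finset.sum_ite_eq, Finset.mem_univ, if_true]

/-- The moment generating function of the random matrix `∑ i ∈ J, b_i b_iᵀ` is at most `m` times that
of a sum of independent variables that equal `C` with probability `s / C` and `0` otherwise. Each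
step averages `trace_exp_rankOne_update_le` over one vector, which is independent of the others. -/
theorem integral_trace_exp_gramSum_le (hmeas : ∀ j, Measurable (b j)) (hindep : iIndepFun b μ)
    (hbound : ∀ j, ∀ᵐ ω ∂μ, ‖b j ω‖ ^ 2 ≤ C) (hC : 0 < C) {s : ℝ} (hs : 0 ≤ s)
    (hmom : ∀ j (k l : Fin m), ∫ ω, b j ω k * b j ω l ∂μ = if k = l then s else 0)
    {θ : ℝ} (hθ : 0 ≤ θ) (J : Finset (Fin n)) :
    ∫ ω, (NormedSpace.exp (θ • gramSum J fun i => b i ω)).trace ∂μ ≤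
      m * (1 + s / C * (Real.exp (θ * C) - 1)) ^ J.card := by
  have hint : ∀ J : Finset (Fin n), Integrable
      (fun ω => (NormedSpace.exp (θ • gramSum J fun i => b i ω)).trace) μ := fun J =>
    integrable_continuous_comp hmeas hbound (continuous_exp_gramSum J θ).matrix_trace
  induction J using Finset.induction_on with
  | empty => simp [gramSum]
  | insert j J hj ih =>
    have hpt : ∀ᵐ ω ∂μ, C * ((NormedSpace.exp (θ • gramSum (insert j J) fun i => b i ω)).trace -
        (NormedSpace.exp (θ • gramSum J fun i => b i ω)).trace) ≤ (Real.exp (θ * C) - 1) *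
        ((b j ω).ofLp ⬝ᵥ NormedSpace.exp (θ • gramSum J fun i => b i ω) *ᵥ (b j ω).ofLp) := by
      filter_upwards [hbound j] with ω hω
      have e : (gramSum (insert j J) fun i => b i ω) =
          (gramSum J fun i => b i ω) + vecMulVec (b j ω).ofLp (b j ω).ofLp := by
        rw [gramSum, Finset.sum_insert hj, add_comm, gramSum]
      rw [e]
      exact trace_exp_rankOne_update_le (gramSum_posSemidef J _)
        ((dotProduct_self_eq_norm_sq _).trans_le hω) hθ
    have hq : Integrable (fun ω => (b j ω).ofLp ⬝ᵥ
        NormedSpace.exp (θ • gramSum J fun i => b i ω) *ᵥ (b j ω).ofLp) μ := by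
      refine integrable_continuous_comp (F := fun x => (x j).ofLp ⬝ᵥ
        NormedSpace.exp (θ • gramSum J x) *ᵥ (x j).ofLp) hmeas hbound ?_
      have hc : Continuous fun x : Fin n → EuclideanSpace ℝ (Fin m) => (x j).ofLp := by fun_prop
      exact hc.dotProduct ((continuous_exp_gramSum J θ).matrix_mulVec hc)
    have h := integral_mono_ae (((hint (insert j J)).sub (hint J)).const_mul C)
      (hq.const_mul (Real.exp (θ * C) - 1)) hpt
    rw [integral_const_mul, integral_const_mul] at h
    simp only [Pi.sub_apply] at h
    rw [integral_sub (hint _) (hint _),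
      integral_quadratic_exp_gramSum hmeas hindep hbound hmom hj θ] at h
    have hκ : 0 ≤ 1 + s / C * (Real.exp (θ * C) - 1) := by
      have : 1 ≤ Real.exp (θ * C) := Real.one_le_exp (by positivity)
      have : 0 ≤ s / C * (Real.exp (θ * C) - 1) := mul_nonneg (by positivity) (by linarith)
      linarith
    rw [Finset.card_insert_of_notMem hj, pow_succ, ← mul_assoc]
    refine le_trans ?_ (mul_le_mul_of_nonneg_right ih hκ)
    refine le_of_mul_le_mul_left ?_ hC
    have e : ∀ T : ℝ, C * (T * (1 + s / C * (Real.exp (θ * C) - 1))) =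
        C * T + (Real.exp (θ * C) - 1) * (s * T) := fun T => by field_simp
    rw [e]
    linarith

end Moments

/-! ### The tail bound for the largest eigenvalue -/

section Tail

variable {Ω : Type*} [MeasurableSpace Ω] {μ : Measure Ω} [IsProbabilityMeasure μ] {m n : ℕ}
  {b : Fin n → Ω → EuclideanSpace ℝ (Fin m)} {C : ℝ}

theorem dotProduct_gramSum_mulVec (J : Finset (Fin n)) (x : Fin n → EuclideanSpace ℝ (Fin m))
    (v : Fin m → ℝ) : v ⬝ᵥ gramSum J x *ᵥ v = ∑ i ∈ J, ((x i).ofLp ⬝ᵥ v) ^ 2 := by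
  rw [gramSum, sum_mulVec, dotProduct_sum]
  simp only [dotProduct_vecMulVec_mulVec]

theorem sum_sq_le_of_trace_exp_lt {x : Fin n → EuclideanSpace ℝ (Fin m)} {θ L : ℝ} (hθ : 0 < θ)
    (h : (NormedSpace.exp (θ • gramSum Finset.univ x)).trace < Real.exp (θ * L))
    (v : Fin m → ℝ) : ∑ i, ((x i).ofLp ⬝ᵥ v) ^ 2 ≤ L * (v ⬝ᵥ v) := by
  rw [← dotProduct_gramSum_mulVec]
  refine dotProduct_mulVec_le_of_eigenvalues_le (gramSum_posSemidef _ x).isHermitian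
    (fun i => ?_) v
  have h1 := (exp_eigenvalue_le_trace_exp (gramSum_posSemidef Finset.univ x) hθ.le i).trans_lt h
  exact (lt_of_mul_lt_mul_left (Real.exp_lt_exp.1 h1) hθ.le).le

theorem sum_sq_le_of_norm_sq_le {x : Fin n → EuclideanSpace ℝ (Fin m)}
    (h : ∀ i, ‖x i‖ ^ 2 ≤ C) (v : Fin m → ℝ) :
    ∑ i, ((x i).ofLp ⬝ᵥ v) ^ 2 ≤ (n * C) * (v ⬝ᵥ v) := by
  have hv : 0 ≤ v ⬝ᵥ v := Finset.sum_nonneg fun i _ => mul_self_nonneg (v i)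
  calc ∑ i, ((x i).ofLp ⬝ᵥ v) ^ 2 ≤ ∑ _i : Fin n, C * (v ⬝ᵥ v) := by
        refine Finset.sum_le_sum fun i _ => ?_
        refine le_trans ?_ (mul_le_mul_of_nonneg_right (h i) hv)
        rw [← dotProduct_self_eq_norm_sq]
        simpa [dotProduct, pow_two] using
          Finset.sum_mul_sq_le_sq_mul_sq Finset.univ (x i).ofLp v
    _ = _ := by simp [mul_assoc]

theorem le_of_covariance (hm : 0 < m) (hmeas : ∀ j, Measurable (b j))
    (hbound : ∀ j, ∀ᵐ ω ∂μ, ‖b j ω‖ ^ 2 ≤ C) {s : ℝ}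
    (hmom : ∀ j (k l : Fin m), ∫ ω, b j ω k * b j ω l ∂μ = if k = l then s else 0) (j : Fin n) :
    s ≤ C := by
  have h := hmom j ⟨0, hm⟩ ⟨0, hm⟩
  rw [if_pos rfl] at h
  rw [← h]
  have hle : ∀ᵐ ω ∂μ, b j ω ⟨0, hm⟩ * b j ω ⟨0, hm⟩ ≤ C := by
    filter_upwards [hbound j] with ω hω
    refine le_trans ?_ hω
    rw [← dotProduct_self_eq_norm_sq]
    exact Finset.single_le_sum (f := fun k => b j ω k * b j ω k)
      (fun k _ => mul_self_nonneg _) (Finset.mem_univ _)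
  have hint := integrable_continuous_comp (F := fun x => x j ⟨0, hm⟩ * x j ⟨0, hm⟩) hmeas hbound
    (by fun_prop)
  simpa using integral_mono_ae hint (integrable_const C) hle

/-- The upper tail of the matrix Bernstein inequality for `∑ i, b_i b_iᵀ`: outside an event of
probability at most `failureBound m n σa C q` its largest eigenvalue is at most `n σa² + q`. -/
theorem exists_event_sum_sq_le (hm : 0 < m) (hmeas : ∀ j, Measurable (b j))
    (hindep : iIndepFun b μ) (hbound : ∀ j, ∀ᵐ ω ∂μ, ‖b j ω‖ ^ 2 ≤ C) {σa : ℝ}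
    (hmom : ∀ j (k l : Fin m), ∫ ω, b j ω k * b j ω l ∂μ = if k = l then σa ^ 2 else 0)
    {q : ℝ} (hq : 0 < q) :
    ∃ E : Set Ω, MeasurableSet E ∧ 1 - failureBound m n σa C q ≤ μ.real E ∧
      ∀ ω ∈ E, (∀ j, ‖b j ω‖ ^ 2 ≤ C) ∧
        ∀ v : Fin m → ℝ, ∑ i, ((b i ω).ofLp ⬝ᵥ v) ^ 2 ≤ (n * σa ^ 2 + q) * (v ⬝ᵥ v) := by
  set A : Set Ω := {ω | ∀ j, ‖b j ω‖ ^ 2 ≤ C} with hA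
  have hAm : MeasurableSet A := by
    rw [hA, Set.ofPred_forall]
    exact MeasurableSet.iInter fun j =>
      measurableSet_le ((hmeas j).norm.pow_const 2) measurable_const
  have hA1 : ∀ᵐ ω ∂μ, ω ∈ A := ae_all_iff.2 hbound
  have hvv : ∀ v : Fin m → ℝ, 0 ≤ v ⬝ᵥ v := fun v =>
    Finset.sum_nonneg fun i _ => mul_self_nonneg (v i)
  -- If `C = σa²`, the trace of the matrix is already at most `n C`. If `n = 0`, the matrix vanishes
  -- and nothing is known about `C`.
  by_cases hdeg : n = 0 ∨ C = σa ^ 2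
  · refine ⟨A, hAm, ?_, fun ω hω => ⟨hω, fun v => ?_⟩⟩
    · rw [measureReal_def, prob_compl_eq_zero_iff hAm |>.1 hA1, ENNReal.toReal_one,
        sub_le_self_iff, failureBound]
      split_ifs <;> positivity
    · refine (sum_sq_le_of_norm_sq_le hω v).trans (mul_le_mul_of_nonneg_right ?_ (hvv v))
      rcases hdeg with h | h
      · simp [h, hq.le]
      · rw [h]; linarith
  · push Not at hdeg
    obtain ⟨hn, hne⟩ := hdeg
    have hle := le_of_covariance hm hmeas hbound hmom ⟨0, Nat.pos_of_ne_zero hn⟩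
    have hR : 0 < C - σa ^ 2 := sub_pos.2 (lt_of_le_of_ne hle hne.symm)
    have hC : 0 < C := by nlinarith [sq_nonneg σa]
    obtain ⟨θ, hθ, hbern⟩ := exists_bernstein_parameter n (sq_nonneg σa) hR hq
    rw [sub_add_cancel] at hbern
    set T : Ω → ℝ := fun ω => (NormedSpace.exp (θ • gramSum Finset.univ fun i => b i ω)).trace
    have hcont := (continuous_exp_gramSum (m := m) (n := n) Finset.univ θ).matrix_trace
    have hTm : Measurable T := hcont.measurable.comp (measurable_pi_lambda _ hmeas)
    have hTi : Integrable T μ := integrable_continuous_comp hmeas hbound hcont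
    have hT0 : 0 ≤ T := fun ω => (Real.exp_nonneg _).trans
      (exp_eigenvalue_le_trace_exp (gramSum_posSemidef Finset.univ fun i => b i ω) hθ.le ⟨0, hm⟩)
    set G : Set Ω := {ω | T ω < Real.exp (θ * (n * σa ^ 2 + q))} with hG
    have hGm : MeasurableSet G := measurableSet_lt hTm measurable_const
    refine ⟨A ∩ G, hAm.inter hGm, ?_, fun ω hω => ⟨hω.1, sum_sq_le_of_trace_exp_lt hθ hω.2⟩⟩
    have hAG : μ.real (A ∩ G) = μ.real G := measureReal_congr (by
      filter_upwards [hA1] with ω hω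
      exact propext ⟨fun h => h.2, fun h => ⟨hω, h⟩⟩)
    have hmarkov := mul_meas_ge_le_integral_of_nonneg (ae_of_all _ hT0) hTi
      (Real.exp (θ * (n * σa ^ 2 + q)))
    have hGc : {ω | Real.exp (θ * (n * σa ^ 2 + q)) ≤ T ω} = Gᶜ := by
      ext ω; simp [hG]
    have hmgf := integral_trace_exp_gramSum_le hmeas hindep hbound hC (sq_nonneg σa) hmom hθ.le
      Finset.univ
    rw [Finset.card_univ, Fintype.card_fin] at hmgf
    rw [hGc, probReal_compl_eq_one_sub hGm] at hmarkov
    rw [hAG, failureBound, if_neg hne]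
    have h := hmarkov.trans (hmgf.trans (mul_le_mul_of_nonneg_left hbern (Nat.cast_nonneg m)))
    rw [Real.exp_add, mul_left_comm] at h
    have := le_of_mul_le_mul_left h (Real.exp_pos _)
    linarith

end Tail

end SensorScheduling

open SensorScheduling in
theorem theorem2 {Ω : Type*} [MeasurableSpace Ω] (μ : Measure Ω) [IsProbabilityMeasure μ]
    {m n : ℕ} (hm : 0 < m)
    -- the linear dynamical system: transition matrices, noise covariances, initial covariance
    (H Q : ℕ → Matrix (Fin m) (Fin m) ℝ) (P₀ : Matrix (Fin m) (Fin m) ℝ) (σ : ℝ)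
    (hQ : ∀ s, (Q s).PosDef) (hP₀ : P₀.PosSemidef) (hσ : 0 < σ)
    -- the measurement vectors and the schedules of all times
    (a : ℕ → Fin n → Ω → EuclideanSpace ℝ (Fin m)) (S : ℕ → Ω → Finset (Fin n))
    -- the hypotheses on the measurement vectors of the present time
    (t : ℕ) (ht : 1 ≤ t) (σa C : ℝ)
    (hmeas : ∀ j, Measurable (a t j))
    (hindep : iIndepFun (fun j => a t j) μ)
    (hmean : ∀ j, ∫ ω, a t j ω ∂μ = 0)
    (hcov : ∀ j, (Matrix.of fun k l : Fin m => cov[fun ω => a t j ω k, fun ω => a t j ω l; μ]) =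
      σa ^ 2 • (1 : Matrix (Fin m) (Fin m) ℝ))
    (hbound : ∀ j, ∀ᵐ ω ∂μ, ‖a t j ω‖ ^ 2 ≤ C)
    (q : ℝ) (hq : 0 < q) :
    ∃ E : Set Ω, MeasurableSet E ∧ 1 - failureBound m n σa C q ≤ μ.real E ∧
      ∀ ω ∈ E,
        let P := predictionCov H Q P₀ σ (fun s j => a s j ω) (fun s => S s ω) t
        let Cmax := maxCurvature (objective σ P fun j => a t j ω)
        let φ := (lamMax (fisher σ P (fun j => a t j ω) Finset.univ))⁻¹
        let φ₀ := (1 / lamMin P + (n * σa ^ 2 + q) / σ ^ 2)⁻¹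
        φ₀ ≤ φ ∧
          Cmax ≤ ENNReal.ofReal (curvatureBound σ C P φ) ∧
          Cmax ≤ ENNReal.ofReal (curvatureBound σ C P φ₀) := by
  obtain ⟨E, hE, hprob, h⟩ := exists_event_sum_sq_le hm hmeas hindep hbound
    (integral_coord_mul_coord hmeas hbound hmean hcov) hq
  refine ⟨E, hE, hprob, fun ω hω => ?_⟩
  obtain ⟨hC, hL⟩ := h ω hω
  intro P Cmax φ φ₀
  have hP : P.PosDef := predictionCov_posDef hQ hP₀ hσ _ _ t
  have hF : 0 < lamMax (fisher σ P (fun j => a t j ω) Finset.univ) :=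
    lamMax_pos hm (fisher_posDef hP hσ _)
  have hφ₀ : 0 < φ₀ := by
    have := lamMin_pos hm hP
    exact inv_pos.2 (by positivity)
  have hle : φ₀ ≤ φ := inv_anti₀ hF (lamMax_fisher_le hm hP hσ hL)
  exact ⟨hle, maxCurvature_objective_le hm hP hσ (inv_pos.2 hF) le_rfl hC,
    maxCurvature_objective_le hm hP hσ hφ₀ hle hC⟩
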